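/- Let $p$ be an odd prime, $k \ge 1$ and $n = pk$. Let $K$ be an algebraically closed field of characteristic different from $p$, let $\alpha \in K$ be a primitive $p$-th root of unity, and let $G = \mathrm{PGL}_n(K)$ with its Zariski topology. For a closed subgroup $H$ of $G$ let $H^\circ$ be the connected component of the identity in $H$. Let $T \le G$ be the maximal torus consisting of the images of the invertible diagonal matrices; an element of $G$ is called toral if it has a conjugate in $T$. Then there is a unique conjugacy class of toral elements of order $p$ in $G$ with disconnected centralizer: the set of all toral elements of order $p$ in $G$ whose centralizer in $G$ is disconnected is a single conjugacy class, namely the conjugacy class of $$e = [\mathrm{diag}(I_k, \alpha I_k, \alpha^2 I_k, \ldots, \alpha^{p-1} I_k)].$$ Moreover $$C_G(e) = C_G(e)^\circ \cdot \langle f \rangle, \qquad C_G(e)^\circ \cap \langle f \rangle = 1,$$ where $f \in G$ is the image of the block permutation matrix with $p \times p$ blocks of size $k \times k$ whose block in position $(i,j)$ is $I_k$ if $j \equiv i+1 \pmod p$ and $0$ otherwise. -/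

import Mathlib

open scoped Pointwise

noncomputable section

namespace PGLCentralizer

variable (n : Type*) [Fintype n] [DecidableEq n] (K : Type*) [Field K]

/-- The projective general linear group: `GL_n(K)` modulo its centre (the scalar matrices). -/
abbrev PGL : Type _ :=
  Matrix.GeneralLinearGroup n K ⧸ Subgroup.center (Matrix.GeneralLinearGroup n K)

variable {n K}

/-- The set of points of `GL_n(K)` at which all polynomials of `S` (in the matrix entries)
vanish. -/
def zeroSet (S : Set (MvPolynomial (n × n) K)) : Set (Matrix.GeneralLinearGroup n K) :=
  {g | ∀ P ∈ S, MvPolynomial.eval (fun ij => (g : Matrix n n K) ij.1 ij.2) P = 0}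

variable (n K)

/-- The Zariski topology on `GL_n(K)`: the closed sets are the zero sets of families of polynomials
in the matrix entries. (The inverse of the determinant need not be allowed: a function `P / det ^ m`
has the same zeros as `P`.) -/
@[reducible] def zariskiGL : TopologicalSpace (Matrix.GeneralLinearGroup n K) :=
  TopologicalSpace.ofClosed {F | ∃ S, F = zeroSet S}
    ⟨{1}, by ext g; simp [zeroSet]⟩
    (by
      intro A hA
      refine ⟨{P | ∃ F ∈ A, ∀ g ∈ F,
        MvPolynomial.eval (fun ij => (g : Matrix n n K) ij.1 ij.2) P = 0}, ?_⟩
      ext g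
      constructor
      · rintro hg P ⟨F, hF, hP⟩
        exact hP g (hg F hF)
      · intro hg F hF
        obtain ⟨S, rfl⟩ := hA hF
        exact fun P hP => hg P ⟨_, hF, fun h hh => hh P hP⟩)
    (by
      rintro _ ⟨S, rfl⟩ _ ⟨T, rfl⟩
      refine ⟨{R | ∃ P ∈ S, ∃ Q ∈ T, R = P * Q}, ?_⟩
      ext g
      constructor
      · rintro (hg | hg) _ ⟨P, hP, Q, hQ, rfl⟩
        · rw [map_mul, hg P hP, zero_mul]
        · rw [map_mul, hg Q hQ, mul_zero]
      · intro hg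
        by_contra hc
        rw [Set.mem_union, not_or] at hc
        obtain ⟨h1, h2⟩ := hc
        simp only [zeroSet, Set.mem_ofPred_eq, not_forall] at h1 h2
        obtain ⟨P, hP, hP0⟩ := h1
        obtain ⟨Q, hQ, hQ0⟩ := h2
        have h := hg _ ⟨P, hP, Q, hQ, rfl⟩
        rw [map_mul] at h
        exact (mul_ne_zero hP0 hQ0) h)

/-- The Zariski topology on the quotient group `PGL_n(K)`: a set is open if and only if its
preimage in `GL_n(K)` is Zariski open. -/
@[reducible] def zariskiPGL : TopologicalSpace (PGL n K) :=
  (zariskiGL n K).coinduced (QuotientGroup.mk)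

variable {n K}

/-- `H°`: the connected component of the identity in the subgroup `H` of `PGL_n(K)`, for the
Zariski topology. -/
def identityComponent (H : Subgroup (PGL n K)) : Set (PGL n K) :=
  @connectedComponentIn (PGL n K) (zariskiPGL n K) (H : Set (PGL n K)) 1

/-- `C_G(x)`: the centralizer in `PGL_n(K)` of the element `x`. -/
abbrev centralizer (x : PGL n K) : Subgroup (PGL n K) := Subgroup.centralizer {x}

/-- The centralizer of `x` is disconnected in the Zariski topology. -/
def HasDisconnectedCentralizer (x : PGL n K) : Prop :=
  ¬ @IsConnected (PGL n K) (zariskiPGL n K) (centralizer x : Set (PGL n K))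

/-- The invertible diagonal matrix with diagonal `d`. -/
def diagGL : (n → Kˣ) →* Matrix.GeneralLinearGroup n K :=
  (Units.map (Matrix.diagonalRingHom n K : (n → K) →* Matrix n n K)).comp
    (MulEquiv.piUnits.symm : (n → Kˣ) ≃* (n → K)ˣ).toMonoidHom

variable (n K)

/-- The maximal torus `T` of `PGL_n(K)`: the image of the group of invertible diagonal matrices. -/
def torus : Subgroup (PGL n K) :=
  ((QuotientGroup.mk' (Subgroup.center (Matrix.GeneralLinearGroup n K))).comp diagGL).range

variable {n K}

/-- An element of `PGL_n(K)` is toral if it has a conjugate in the maximal torus `T`. -/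
def IsToral (x : PGL n K) : Prop := ∃ t ∈ torus n K, IsConj x t

/-- The permutation matrix of `σ`, with `(i, σ i)` entry equal to `1`, as an element of `GL_n(K)`. -/
def permGL (σ : Equiv.Perm n) : Matrix.GeneralLinearGroup n K where
  val := σ.permMatrix K
  inv := (σ⁻¹).permMatrix K
  val_inv := by rw [← Matrix.permMatrix_mul]; simp
  inv_val := by rw [← Matrix.permMatrix_mul]; simp

/-- The class in `PGL_{pk}(K)` of the block diagonal matrix
`diag(I_k, α I_k, …, α^(p-1) I_k)`. The bijection `finProdFinEquiv` sends (block `i`, position `a`)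
to the index `a + k * i`. -/
def e (p k : ℕ) (α : Kˣ) : PGL (Fin (p * k)) K :=
  QuotientGroup.mk (diagGL fun i => α ^ ((finProdFinEquiv.symm i).1 : ℕ))

variable (K)

/-- The class in `PGL_{pk}(K)` of the block cyclic permutation matrix, with blocks of size `k`: in
block row `i` the only nonzero block is an `I_k` in block column `i + 1` modulo `p`. -/
def f (p k : ℕ) : PGL (Fin (p * k)) K :=
  QuotientGroup.mk (permGL (finProdFinEquiv.permCongr ((finRotate p).prodCongr (Equiv.refl (Fin k)))))

end PGLCentralizer

end

open scoped Pointwise Topology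

noncomputable section

namespace PGLCentralizer

open Matrix

/-! ### Centralizers in `PGL` of classes of matrices of finite order -/

section General

variable {n : Type*} [Fintype n] [DecidableEq n] {K : Type*} [Field K]

/-! Let `g ^ p = 1`. A class `[h]` centralizes `[g]` iff `h g h⁻¹ = c g` for a scalar `c`, and then
`c ^ p = 1`. So the centralizer is a disjoint union of finitely many closed pieces indexed by `p`-th
roots of unity. Each piece comes from the invertible points of a linear space of matrices, hence is
irreducible or empty (`isPreirreducible_twistedCentralizer`). Thus the identity component is the
piece `c = 1`, and the centralizer is disconnected iff another piece is nonempty.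

Up to conjugacy a toral element of order `p` is the class of a diagonal matrix of `p`-th roots of
unity. A nonempty piece with `c ≠ 1` makes the eigenvalue multiset stable under `c`, hence under all
`p`-th roots of unity since `p` is prime. All multiplicities then agree (`mul_card_fiber_eq`), which
fixes the matrix up to permutation. Finally `f` has a lift of exponent `p` in the piece `α`, so its
powers meet each piece exactly once and give the complement. -/

theorem isClosed_zariskiGL_iff {F : Set (GL n K)} :
    IsClosed[zariskiGL n K] F ↔ ∃ S, F = zeroSet S := by
  rw [← @isOpen_compl_iff _ _ (zariskiGL n K)]
  change Fᶜᶜ ∈ {F : Set (GL n K) | ∃ S, F = zeroSet S} ↔ _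
  rw [compl_compl]
  rfl

/-- A point of a Zariski open set has a principal open neighbourhood inside it. -/
theorem exists_polynomial_of_isOpen {U : Set (GL n K)} (hU : IsOpen[zariskiGL n K] U)
    {a : GL n K} (ha : a ∈ U) :
    ∃ P : MvPolynomial (n × n) K,
      MvPolynomial.eval (fun ij => (a : Matrix n n K) ij.1 ij.2) P ≠ 0 ∧
      ∀ g : GL n K, MvPolynomial.eval (fun ij => (g : Matrix n n K) ij.1 ij.2) P ≠ 0 → g ∈ U := by
  obtain ⟨S, hS⟩ : ∃ S, Uᶜ = zeroSet S := hU
  have ha' : a ∉ zeroSet S := by rw [← hS]; simpa using ha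
  simp only [zeroSet, Set.mem_ofPred_eq, not_forall] at ha'
  obtain ⟨P, hP, hPa⟩ := ha'
  refine ⟨P, hPa, fun g hg => ?_⟩
  by_contra hgU
  have : g ∈ zeroSet S := hS ▸ hgU
  exact hg (this P hP)

/-- The scalar matrices as elements of the general linear group. -/
abbrev scalarGL : Kˣ →* GL n K := GeneralLinearGroup.scalar n

@[simp]
theorem coe_scalarGL (c : Kˣ) : (scalarGL c : GL n K).val = Matrix.scalar n (c : K) := rfl

theorem scalarGL_mem_center (c : Kˣ) :
    (scalarGL c : GL n K) ∈ Subgroup.center (GL n K) :=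
  GeneralLinearGroup.mem_center_iff_val_mem_range_scalar.2 ⟨c, rfl⟩

theorem scalarGL_comm (c : Kˣ) (g : GL n K) : g * scalarGL c = scalarGL c * g :=
  Subgroup.mem_center_iff.1 (scalarGL_mem_center c) g

theorem scalarGL_injective [Nonempty n] : Function.Injective (scalarGL : Kˣ → GL n K) := by
  intro a b h
  have h1 := congrArg (fun g : GL n K => g.val) h
  simp only [coe_scalarGL] at h1
  exact Units.ext (Matrix.scalar_inj.1 h1)

theorem mem_center_iff_exists_scalarGL [Nonempty n] {g : GL n K} :
    g ∈ Subgroup.center (GL n K) ↔ ∃ c, g = scalarGL c := by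
  refine ⟨fun h => ?_, ?_⟩
  · obtain ⟨a, ha⟩ := GeneralLinearGroup.mem_center_iff_val_mem_range_scalar.1 h
    have ha0 : a ≠ 0 := by
      rintro rfl
      rw [map_zero] at ha
      exact g.ne_zero ha.symm
    exact ⟨Units.mk0 a ha0, Units.ext ha.symm⟩
  · rintro ⟨c, rfl⟩
    exact scalarGL_mem_center c

theorem mk_eq_mk_iff [Nonempty n] {g h : GL n K} :
    (QuotientGroup.mk g : PGL n K) = QuotientGroup.mk h ↔ ∃ c, h = scalarGL c * g := by
  rw [QuotientGroup.eq, mem_center_iff_exists_scalarGL]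
  refine exists_congr fun c => ?_
  rw [inv_mul_eq_iff_eq_mul, scalarGL_comm]

/-- The matrices which commute with `g` up to the scalar `c`. -/
def twistedCentralizer (g : GL n K) (c : Kˣ) : Set (GL n K) :=
  {h | h * g = scalarGL c * (g * h)}

theorem mem_twistedCentralizer {g h : GL n K} {c : Kˣ} :
    h ∈ twistedCentralizer g c ↔ h * g = scalarGL c * (g * h) := Iff.rfl

theorem mk_mem_centralizer_iff [Nonempty n] {g h : GL n K} :
    (QuotientGroup.mk h : PGL n K) ∈ centralizer (QuotientGroup.mk g : PGL n K) ↔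
      ∃ c, h ∈ twistedCentralizer g c := by
  rw [Subgroup.mem_centralizer_singleton_iff]
  constructor
  · intro hc
    exact mk_eq_mk_iff.1 (show (QuotientGroup.mk (g * h) : PGL n K) = QuotientGroup.mk (h * g) by
      simpa using hc.symm)
  · rintro ⟨c, hc⟩
    exact (mk_eq_mk_iff.2 ⟨c, hc⟩ :
      (QuotientGroup.mk (g * h) : PGL n K) = QuotientGroup.mk (h * g)).symm

theorem pow_eq_one_of_mem_twistedCentralizer [Nonempty n] {g h : GL n K} {c : Kˣ} {p : ℕ}
    (hg : g ^ p = 1) (h_mem : h ∈ twistedCentralizer g c) : c ^ p = 1 := by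
  have h1 : h * g * h⁻¹ = scalarGL c * g := by
    rw [mul_inv_eq_iff_eq_mul, mul_assoc]; exact h_mem
  have h2 := congrArg (· ^ p) h1
  simp only [conj_pow, hg, mul_one, mul_inv_cancel] at h2
  rw [(show Commute (scalarGL c) g from (scalarGL_comm c g).symm).mul_pow, hg, mul_one,
    ← map_pow] at h2
  exact scalarGL_injective (h2.symm.trans (map_one _).symm)

theorem eq_of_mem_twistedCentralizer [Nonempty n] {g h : GL n K} {c d : Kˣ}
    (hc : h ∈ twistedCentralizer g c) (hd : h ∈ twistedCentralizer g d) : c = d :=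
  scalarGL_injective (mul_right_cancel (hc.symm.trans hd))

theorem scalarGL_mul_mem_twistedCentralizer {g h : GL n K} {c d : Kˣ}
    (hc : h ∈ twistedCentralizer g c) : scalarGL d * h ∈ twistedCentralizer g c := by
  rw [mem_twistedCentralizer] at hc ⊢
  rw [mul_assoc, hc, ← mul_assoc g, scalarGL_comm d g, mul_assoc (scalarGL d),
    ← mul_assoc (scalarGL d), scalarGL_comm c (scalarGL d), mul_assoc]

/-- The pieces are stable under scalars, so membership can be tested on any lift; this is what makes
their images closed in the quotient topology. -/
theorem mk_mem_image_twistedCentralizer_iff [Nonempty n] {g h : GL n K} {c : Kˣ} :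
    (QuotientGroup.mk h : PGL n K) ∈ (QuotientGroup.mk '' twistedCentralizer g c : Set (PGL n K)) ↔
      h ∈ twistedCentralizer g c := by
  refine ⟨?_, fun hh => ⟨h, hh, rfl⟩⟩
  rintro ⟨h', hh', h_eq⟩
  obtain ⟨d, rfl⟩ := mk_eq_mk_iff.1 h_eq
  exact scalarGL_mul_mem_twistedCentralizer hh'

theorem mul_mem_twistedCentralizer {g h h' : GL n K} {c c' : Kˣ}
    (hc : h ∈ twistedCentralizer g c) (hc' : h' ∈ twistedCentralizer g c') :
    h * h' ∈ twistedCentralizer g (c * c') := by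
  rw [mem_twistedCentralizer] at hc hc' ⊢
  rw [mul_assoc, hc', ← mul_assoc h, scalarGL_comm, mul_assoc, ← mul_assoc h, hc, map_mul,
    scalarGL_comm c' (scalarGL c)]
  simp only [mul_assoc]

theorem one_mem_twistedCentralizer (g : GL n K) : 1 ∈ twistedCentralizer g 1 := by
  simp [mem_twistedCentralizer]

theorem inv_mem_twistedCentralizer {g h : GL n K} {c : Kˣ}
    (hc : h ∈ twistedCentralizer g c) : h⁻¹ ∈ twistedCentralizer g c⁻¹ := by
  rw [mem_twistedCentralizer] at hc ⊢
  rw [map_inv, eq_inv_mul_iff_mul_eq]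
  refine mul_left_cancel (a := h) ?_
  rw [← mul_assoc h, scalarGL_comm, mul_assoc, mul_inv_cancel_left, ← mul_assoc h, hc, mul_assoc,
    mul_assoc, mul_inv_cancel, mul_one]

theorem pow_mem_twistedCentralizer {g h : GL n K} {c : Kˣ}
    (hc : h ∈ twistedCentralizer g c) (m : ℕ) : h ^ m ∈ twistedCentralizer g (c ^ m) := by
  induction m with
  | zero => simpa using one_mem_twistedCentralizer g
  | succ m ih =>
    rw [pow_succ, pow_succ]
    exact mul_mem_twistedCentralizer ih hc

theorem isClosed_twistedCentralizer (g : GL n K) (c : Kˣ) :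
    IsClosed[zariskiGL n K] (twistedCentralizer g c) := by
  refine isClosed_zariskiGL_iff.2 ⟨Set.range fun ij : n × n =>
    ∑ l, MvPolynomial.X (ij.1, l) * MvPolynomial.C ((g : Matrix n n K) l ij.2) -
      MvPolynomial.C (c : K) *
        ∑ l, MvPolynomial.C ((g : Matrix n n K) ij.1 l) * MvPolynomial.X (l, ij.2), ?_⟩
  ext h
  simp only [mem_twistedCentralizer, zeroSet, Set.forall_mem_range, Set.mem_ofPred_eq, map_sub,
    map_sum, map_mul, MvPolynomial.eval_X, MvPolynomial.eval_C, sub_eq_zero, Prod.forall,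
    Units.ext_iff, Units.val_mul, ← Matrix.ext_iff, coe_scalarGL, Matrix.scalar_apply,
    Matrix.diagonal_mul]
  simp only [Matrix.mul_apply]

theorem isClosed_image_twistedCentralizer [Nonempty n] (g : GL n K) (c : Kˣ) :
    IsClosed[zariskiPGL n K] (QuotientGroup.mk '' twistedCentralizer g c : Set (PGL n K)) := by
  refine isClosed_coinduced.2 ?_
  convert isClosed_twistedCentralizer g c
  ext h
  exact mk_mem_image_twistedCentralizer_iff

open Polynomial in
-- The defining equation is linear in `h`, so it holds along the line through two solutions. Two
-- principal open conditions and the determinant each restrict to a nonzero polynomial on that line,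
-- and over an infinite field their product is nonzero at some point.
theorem isPreirreducible_twistedCentralizer [Infinite K] (g : GL n K) (c : Kˣ) :
    @IsPreirreducible _ (zariskiGL n K) (twistedCentralizer g c) := by
  rintro U V hU hV ⟨a, ha, haU⟩ ⟨b, hb, hbV⟩
  obtain ⟨P, hPa, hPU⟩ := exists_polynomial_of_isOpen hU haU
  obtain ⟨Q, hQb, hQV⟩ := exists_polynomial_of_isOpen hV hbV
  let A : Matrix n n K := a
  let B : Matrix n n K := b
  let M : Matrix n n K[X] := A.map C + (X : K[X]) • (B - A).map C
  have hM : ∀ t : K, M.map (eval t) = A + t • (B - A) := by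
    intro t
    ext i j
    simp [M]
  have hMt : ∀ (t : K) (R : MvPolynomial (n × n) K),
      eval t (MvPolynomial.aeval (fun ij : n × n => M ij.1 ij.2) R) =
        MvPolynomial.eval (fun ij => (A + t • (B - A)) ij.1 ij.2) R := by
    intro t R
    rw [← hM, ← coe_evalRingHom, MvPolynomial.aeval_def, MvPolynomial.hom_eval₂]
    have : (evalRingHom t).comp (algebraMap K K[X]) = RingHom.id K := by
      ext x; simp
    rw [this]
    rfl
  have hdet : ∀ t : K, eval t M.det = (A + t • (B - A)).det := by
    intro t
    rw [← hM, ← coe_evalRingHom, RingHom.map_det]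
    rfl
  have h0 : A + (0 : K) • (B - A) = A := by simp
  have h1 : A + (1 : K) • (B - A) = B := by simp
  have hne : MvPolynomial.aeval (fun ij : n × n => M ij.1 ij.2) P *
      MvPolynomial.aeval (fun ij : n × n => M ij.1 ij.2) Q * M.det ≠ 0 := by
    refine mul_ne_zero (mul_ne_zero ?_ ?_) ?_
    · intro hz
      have := hMt 0 P
      rw [hz, eval_zero, h0] at this
      exact hPa this.symm
    · intro hz
      have := hMt 1 Q
      rw [hz, eval_zero, h1] at this
      exact hQb this.symm
    · intro hz
      have := hdet 0
      rw [hz, eval_zero, h0] at this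
      exact (Matrix.isUnit_iff_isUnit_det A).1 a.isUnit |>.ne_zero this.symm
  obtain ⟨t, ht⟩ : ∃ t : K, eval t (MvPolynomial.aeval (fun ij : n × n => M ij.1 ij.2) P *
      MvPolynomial.aeval (fun ij : n × n => M ij.1 ij.2) Q * M.det) ≠ 0 := by
    by_contra! hall
    exact hne (Polynomial.funext fun t => by rw [hall t, eval_zero])
  rw [eval_mul, eval_mul, hMt, hMt, hdet] at ht
  have htd := right_ne_zero_of_mul ht
  have htP := left_ne_zero_of_mul (left_ne_zero_of_mul ht)
  have htQ := right_ne_zero_of_mul (left_ne_zero_of_mul ht)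
  let x : GL n K := GeneralLinearGroup.mkOfDetNeZero (A + t • (B - A)) htd
  have hx : (x : Matrix n n K) = A + t • (B - A) := rfl
  refine ⟨x, ?_, hPU x htP, hQV x htQ⟩
  have ha' : A * g = Matrix.scalar n (c : K) * (g * A) := congrArg Units.val ha
  have hb' : B * g = Matrix.scalar n (c : K) * (g * B) := congrArg Units.val hb
  refine Units.ext ?_
  change (A + t • (B - A)) * (g : Matrix n n K) =
    Matrix.scalar n (c : K) * (g * (A + t • (B - A)))
  simp only [add_mul, mul_add, smul_mul_assoc, mul_smul_comm, sub_mul, mul_sub, ha', hb']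

theorem isPreconnected_image_twistedCentralizer [Infinite K] (g : GL n K) (c : Kˣ) :
    @IsPreconnected _ (zariskiPGL n K)
      (QuotientGroup.mk '' twistedCentralizer g c : Set (PGL n K)) := by
  let _ := zariskiGL n K
  let _ := zariskiPGL n K
  exact (isPreirreducible_twistedCentralizer g c).isPreconnected.image _
    continuous_coinduced_rng.continuousOn

theorem finite_rootsOfUnity (p : ℕ) [NeZero p] : (rootsOfUnity p K : Set Kˣ).Finite :=
  Set.finite_coe_iff.1 (inferInstanceAs (Finite (rootsOfUnity p K)))

/-- When `g` has finite order, a preconnected subset of the centralizer of `[g]` which contains the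
identity consists of classes of matrices commuting with `g`. -/
theorem subset_image_twistedCentralizer_one [Nonempty n] {g : GL n K} {p : ℕ} (hp : 0 < p)
    (hg : g ^ p = 1) {s : Set (PGL n K)} (hs : s ⊆ centralizer (QuotientGroup.mk g : PGL n K))
    (h1 : 1 ∈ s) (hconn : @IsPreconnected _ (zariskiPGL n K) s) :
    s ⊆ QuotientGroup.mk '' twistedCentralizer g 1 := by
  let _ := zariskiPGL n K
  have : NeZero p := ⟨hp.ne'⟩
  -- All the other pieces together: closed because only finitely many `c` occur.
  let D : Set (PGL n K) := ⋃ c ∈ {c : Kˣ | c ^ p = 1 ∧ c ≠ 1},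
    QuotientGroup.mk '' twistedCentralizer g c
  have hfin : {c : Kˣ | c ^ p = 1 ∧ c ≠ 1}.Finite :=
    Set.Finite.subset (finite_rootsOfUnity p) fun c hc =>
      (mem_rootsOfUnity p c).2 hc.1
  have hD : IsClosed D := hfin.isClosed_biUnion fun c _ => isClosed_image_twistedCentralizer g c
  have hcover : s ⊆ (QuotientGroup.mk '' twistedCentralizer g 1) ∪ D := by
    intro x hx
    obtain ⟨h, rfl⟩ := QuotientGroup.mk_surjective x
    obtain ⟨c, hc⟩ := mk_mem_centralizer_iff.1 (hs hx)
    by_cases hc1 : c = 1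
    · exact Or.inl ⟨h, hc1 ▸ hc, rfl⟩
    · exact Or.inr (Set.mem_biUnion
        (show c ∈ {c : Kˣ | c ^ p = 1 ∧ c ≠ 1} from
          ⟨pow_eq_one_of_mem_twistedCentralizer hg hc, hc1⟩) ⟨h, hc, rfl⟩)
  intro x hx
  by_contra hx1
  have hxD : x ∈ D := (hcover hx).resolve_left hx1
  obtain ⟨y, -, ⟨h, hh, rfl⟩, hyD⟩ := isPreconnected_closed_iff.1 hconn _ _
    (isClosed_image_twistedCentralizer g 1) hD hcover
    ⟨1, h1, ⟨1, one_mem_twistedCentralizer g, rfl⟩⟩ ⟨x, hx, hxD⟩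
  simp only [D, Set.mem_iUnion] at hyD
  obtain ⟨c, hc, hc'⟩ := hyD
  exact hc.2 (eq_of_mem_twistedCentralizer (mk_mem_image_twistedCentralizer_iff.1 hc') hh)

theorem image_twistedCentralizer_subset [Nonempty n] (g : GL n K) (c : Kˣ) :
    (QuotientGroup.mk '' twistedCentralizer g c : Set (PGL n K)) ⊆
      centralizer (QuotientGroup.mk g : PGL n K) := by
  rintro _ ⟨h, hh, rfl⟩
  exact mk_mem_centralizer_iff.2 ⟨c, hh⟩

theorem identityComponent_centralizer_mk [Nonempty n] [Infinite K] {g : GL n K} {p : ℕ}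
    (hp : 0 < p) (hg : g ^ p = 1) :
    identityComponent (centralizer (QuotientGroup.mk g : PGL n K)) =
      QuotientGroup.mk '' twistedCentralizer g 1 := by
  let _ := zariskiPGL n K
  have hmem : (1 : PGL n K) ∈ (centralizer (QuotientGroup.mk g : PGL n K) : Set (PGL n K)) :=
    one_mem _
  refine Set.Subset.antisymm ?_ ?_
  · exact subset_image_twistedCentralizer_one hp hg (connectedComponentIn_subset _ _)
      (mem_connectedComponentIn hmem) isPreconnected_connectedComponentIn
  · exact (isPreconnected_image_twistedCentralizer g 1).subset_connectedComponentIn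
      ⟨1, one_mem_twistedCentralizer g, rfl⟩ (image_twistedCentralizer_subset g 1)

theorem hasDisconnectedCentralizer_mk_iff [Nonempty n] [Infinite K] {g : GL n K} {p : ℕ}
    (hp : 0 < p) (hg : g ^ p = 1) :
    HasDisconnectedCentralizer (QuotientGroup.mk g : PGL n K) ↔
      ∃ c ≠ 1, (twistedCentralizer g c).Nonempty := by
  let _ := zariskiPGL n K
  constructor
  · intro h
    by_contra! hc
    refine h ⟨⟨1, one_mem _⟩, ?_⟩
    convert isPreconnected_image_twistedCentralizer g 1
    refine Set.Subset.antisymm ?_ (image_twistedCentralizer_subset g 1)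
    intro x hx
    obtain ⟨h, rfl⟩ := QuotientGroup.mk_surjective x
    obtain ⟨c, hc'⟩ := mk_mem_centralizer_iff.1 hx
    by_cases hc1 : c = 1
    · exact ⟨h, hc1 ▸ hc', rfl⟩
    · exact absurd hc' (by simp [hc c hc1])
  · rintro ⟨c, hc1, h, hh⟩ hconn
    have := subset_image_twistedCentralizer_one hp hg subset_rfl (one_mem _) hconn.isPreconnected
      (mk_mem_centralizer_iff.2 ⟨c, hh⟩)
    exact hc1 (eq_of_mem_twistedCentralizer hh (mk_mem_image_twistedCentralizer_iff.1 this))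

end General

/-! ### Diagonal matrices, eigenvalue multiplicities and toral elements -/

section Diagonal

variable {n : Type*} [Fintype n] [DecidableEq n] {K : Type*} [Field K]

@[simp]
theorem coe_diagGL (d : n → Kˣ) :
    (diagGL d : GL n K).val = Matrix.diagonal fun i => (d i : K) := rfl

theorem diagGL_const (c : Kˣ) : (diagGL fun _ => c : GL n K) = scalarGL c := rfl

theorem conj_mem_twistedCentralizer {g h : GL n K} {c : Kˣ} (a : GL n K)
    (hc : h ∈ twistedCentralizer g c) :
    a * h * a⁻¹ ∈ twistedCentralizer (a * g * a⁻¹) c := by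
  rw [mem_twistedCentralizer] at hc ⊢
  calc a * h * a⁻¹ * (a * g * a⁻¹) = a * (h * g) * a⁻¹ := by group
    _ = a * scalarGL c * (g * h) * a⁻¹ := by rw [hc]; group
    _ = scalarGL c * (a * g * a⁻¹ * (a * h * a⁻¹)) := by rw [scalarGL_comm]; group

theorem hasDisconnectedCentralizer_iff_of_isConj [Nonempty n] [Infinite K] {g : GL n K} {p : ℕ}
    (hp : 0 < p) (hg : g ^ p = 1) {y : PGL n K} (hy : IsConj (QuotientGroup.mk g : PGL n K) y) :
    HasDisconnectedCentralizer (QuotientGroup.mk g : PGL n K) ↔ HasDisconnectedCentralizer y := by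
  obtain ⟨b, rfl⟩ := isConj_iff.1 hy
  obtain ⟨a, rfl⟩ := QuotientGroup.mk_surjective b
  refine (hasDisconnectedCentralizer_mk_iff hp hg).trans (Iff.trans ?_
    (hasDisconnectedCentralizer_mk_iff hp (g := a * g * a⁻¹)
      (by rw [conj_pow, hg]; simp)).symm)
  refine exists_congr fun c => and_congr_right fun _ => ⟨fun ⟨x, hx⟩ => ?_, fun ⟨x, hx⟩ => ?_⟩
  · exact ⟨_, conj_mem_twistedCentralizer a hx⟩
  · refine ⟨a⁻¹ * x * a⁻¹⁻¹, ?_⟩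
    convert conj_mem_twistedCentralizer a⁻¹ hx using 2
    group

theorem permGL_mul_diagGL (σ : Equiv.Perm n) (d : n → Kˣ) :
    permGL σ * diagGL d = diagGL (d ∘ σ) * (permGL σ : GL n K) := by
  refine Units.ext ?_
  change σ.permMatrix K * Matrix.diagonal (fun i => (d i : K)) =
    Matrix.diagonal (fun i => (d (σ i) : K)) * σ.permMatrix K
  ext i j
  rw [Matrix.mul_diagonal, Matrix.diagonal_mul]
  simp only [Equiv.Perm.permMatrix, PEquiv.toMatrix_apply, Equiv.toPEquiv_apply,
    Option.mem_some_iff]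
  split_ifs with h
  · rw [h, mul_comm]
  · simp

theorem permGL_mul (σ τ : Equiv.Perm n) :
    (permGL (σ * τ) : GL n K) = permGL τ * permGL σ :=
  Units.ext (Matrix.permMatrix_mul ..)

theorem permGL_one : (permGL 1 : GL n K) = 1 := Units.ext Matrix.permMatrix_one

theorem permGL_pow (σ : Equiv.Perm n) (m : ℕ) : (permGL σ : GL n K) ^ m = permGL (σ ^ m) := by
  induction m with
  | zero => rw [pow_zero, pow_zero, permGL_one]
  | succ m ih => rw [pow_succ', pow_succ, permGL_mul, ih]

/-- If `diag d` is conjugate to `c • diag d`, then the multiset of eigenvalues is stable under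
multiplication by `c`. -/
theorem card_fiber_mul_of_mem_twistedCentralizer [DecidableEq K] {d : n → Kˣ} {h : GL n K} {c : Kˣ}
    (hc : h ∈ twistedCentralizer (diagGL d) c) (a : Kˣ) :
    Fintype.card {i // d i = c * a} = Fintype.card {i // d i = a} := by
  have h1 : h * diagGL d * h⁻¹ = diagGL fun i => c * d i := by
    rw [mul_inv_eq_iff_eq_mul, mem_twistedCentralizer.1 hc, ← mul_assoc, ← diagGL_const, ← map_mul]
    rfl
  have h2 : (Matrix.diagonal fun i => ((c * d i : Kˣ) : K)).charpoly =
      (Matrix.diagonal fun i => (d i : K)).charpoly := by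
    rw [← coe_diagGL, ← coe_diagGL, ← h1]
    simp only [Units.val_mul, Matrix.coe_units_inv, Matrix.charpoly_units_conj]
  have hroots : ∀ v : n → K, (Matrix.diagonal v).charpoly.roots = Finset.univ.val.map v := by
    intro v
    rw [Matrix.charpoly_diagonal, Polynomial.roots_prod _ _
      (Finset.prod_ne_zero_iff.2 fun i _ => Polynomial.X_sub_C_ne_zero _)]
    simp
  have h3 := congrArg Polynomial.roots h2
  rw [hroots, hroots] at h3
  -- The value `c * a` occurs in `c * d` as often as `a` occurs in `d`.
  have h4 := congrArg (Multiset.count ((c * a : Kˣ) : K)) h3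
  rw [Multiset.count_map, Multiset.count_map, ← Finset.filter_val, ← Finset.filter_val,
    Finset.card_val, Finset.card_val] at h4
  simp only [Units.val_inj, mul_right_inj] at h4
  rw [Fintype.card_subtype, Fintype.card_subtype]
  simp only [eq_comm (b := a), eq_comm (b := c * a)]
  exact h4.symm

/-- A family of `p`-th roots of unity with multiplicities stable under multiplication by a
primitive root takes all its values equally often. -/
theorem mul_card_fiber_eq {ι : Type*} [Fintype ι] [DecidableEq K] {p : ℕ} [NeZero p] {α : Kˣ}
    (hα : IsPrimitiveRoot α p) {d : ι → Kˣ} (hd : ∀ i, d i ^ p = 1)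
    (hcard : ∀ a, Fintype.card {i // d i = α * a} = Fintype.card {i // d i = a}) {a : Kˣ}
    (ha : a ^ p = 1) : p * Fintype.card {i // d i = a} = Fintype.card ι := by
  have hpow : ∀ m : ℕ, Fintype.card {i // d i = α ^ m} = Fintype.card {i // d i = 1} := by
    intro m
    induction m with
    | zero => simp only [pow_zero]
    | succ m ih => rw [← ih]; simp only [pow_succ']; exact hcard _
  have hroot : ∀ b : Kˣ, b ^ p = 1 → ∃ m < p, α ^ m = b := by
    intro b hb
    obtain ⟨m, hm, h⟩ := (IsPrimitiveRoot.coe_units_iff.2 hα).eq_pow_of_pow_eq_one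
      (show (b : K) ^ p = 1 by rw [← Units.val_pow_eq_pow_val, hb, Units.val_one])
    exact ⟨m, hm, Units.ext (by simpa using h)⟩
  obtain ⟨m, -, rfl⟩ := hroot a ha
  rw [hpow, ← Finset.card_univ (α := ι), Finset.card_eq_sum_card_fiberwise (f := d)
    (t := (Finset.range p).image (α ^ ·)) fun i _ => by
      obtain ⟨m, hm, h⟩ := hroot _ (hd i)
      exact Finset.mem_coe.2 (Finset.mem_image.2 ⟨m, Finset.mem_range.2 hm, h⟩),
    Finset.sum_image fun i hi j hj h =>
      hα.pow_inj (Finset.mem_range.1 hi) (Finset.mem_range.1 hj) h]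
  simp only [← Fintype.card_subtype, hpow, Finset.sum_const, Finset.card_range, smul_eq_mul]

/-- Bijections between the fibres glue to a permutation of the indices, whose matrix conjugates one
diagonal matrix to the other. -/
theorem isConj_diagGL_of_card_fiber {d d' : n → Kˣ} [DecidableEq K]
    (h : ∀ a, Fintype.card {i // d i = a} = Fintype.card {i // d' i = a}) :
    IsConj (diagGL d : GL n K) (diagGL d') := by
  let σ : Equiv.Perm n := Equiv.ofFiberEquiv fun a => Fintype.equivOfCardEq (h a)
  have hσ : d' ∘ σ = d := funext fun i => Equiv.ofFiberEquiv_map _ i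
  refine IsConj.symm (isConj_iff.2 ⟨permGL σ, ?_⟩)
  rw [permGL_mul_diagGL, hσ, mul_inv_cancel_right]

/-- Diagonal matrices of exponent `p` conjugate to a nontrivial multiple of themselves are
conjugate to each other. -/
theorem isConj_diagGL_of_twistedCentralizer_nonempty {p : ℕ} (hp : p.Prime) {α : Kˣ}
    (hα : IsPrimitiveRoot α p) {d d' : n → Kˣ} (hd : ∀ i, d i ^ p = 1) (hd' : ∀ i, d' i ^ p = 1)
    (h : (twistedCentralizer (diagGL d : GL n K) α).Nonempty)
    (h' : (twistedCentralizer (diagGL d' : GL n K) α).Nonempty) :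
    IsConj (diagGL d : GL n K) (diagGL d') := by
  classical
  have : NeZero p := ⟨hp.ne_zero⟩
  obtain ⟨x, hx⟩ := h
  obtain ⟨x', hx'⟩ := h'
  refine isConj_diagGL_of_card_fiber fun a => ?_
  by_cases ha : a ^ p = 1
  · exact Nat.eq_of_mul_eq_mul_left hp.pos <|
      (mul_card_fiber_eq hα hd (card_fiber_mul_of_mem_twistedCentralizer hx) ha).trans
        (mul_card_fiber_eq hα hd' (card_fiber_mul_of_mem_twistedCentralizer hx') ha).symm
  · rw [Fintype.card_eq_zero_iff.2 ⟨fun i : {i // d i = a} => ha (i.2 ▸ hd i)⟩,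
      Fintype.card_eq_zero_iff.2 ⟨fun i : {i // d' i = a} => ha (i.2 ▸ hd' i)⟩]

theorem diagGL_pow_eq_one {p : ℕ} {d : n → Kˣ} (hd : ∀ i, d i ^ p = 1) :
    (diagGL d : GL n K) ^ p = 1 := by
  rw [← map_pow, show d ^ p = 1 from funext hd, map_one]

/-- A toral element killed by `p` is conjugate to the class of a diagonal matrix whose entries are
`p`-th roots of unity. -/
theorem IsToral.exists_isConj_diagGL [Nonempty n] [IsAlgClosed K] {p : ℕ} (hp : 0 < p)
    {x : PGL n K} (hx : IsToral x) (hxp : x ^ p = 1) :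
    ∃ d : n → Kˣ, (∀ i, d i ^ p = 1) ∧ IsConj x (QuotientGroup.mk (diagGL d) : PGL n K) := by
  obtain ⟨_, ⟨d, rfl⟩, hconj⟩ := hx
  have hpow : (QuotientGroup.mk (diagGL (d ^ p)) : PGL n K) = 1 := by
    obtain ⟨b, hb⟩ := isConj_iff.1 hconj
    have : (QuotientGroup.mk (diagGL d) : PGL n K) ^ p = 1 := by
      rw [show (QuotientGroup.mk (diagGL d) : PGL n K) = b * x * b⁻¹ from hb.symm, conj_pow, hxp]
      simp
    rw [map_pow]
    exact this
  obtain ⟨c, hc⟩ := mem_center_iff_exists_scalarGL.1 ((QuotientGroup.eq_one_iff _).1 hpow)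
  have hdc : ∀ i, d i ^ p = c := by
    intro i
    have := congrArg (fun g : GL n K => g.val i i) hc
    exact Units.ext (by simpa [Matrix.diagonal_pow] using this)
  -- Dividing `d` by a `p`-th root of the scalar `d ^ p` keeps the class and makes the lift itself
  -- have exponent `p`.
  obtain ⟨r, hr⟩ := IsAlgClosed.exists_pow_nat_eq (c : K) hp
  have hr0 : r ≠ 0 := by
    rintro rfl
    rw [zero_pow hp.ne'] at hr
    exact c.ne_zero hr.symm
  have hrc : Units.mk0 r hr0 ^ p = c := Units.ext (by simpa using hr)
  refine ⟨fun i => (Units.mk0 r hr0)⁻¹ * d i, fun i => ?_, ?_⟩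
  · rw [mul_pow, inv_pow, hrc, hdc, inv_mul_cancel]
  · convert hconj using 1
    refine mk_eq_mk_iff.2 ⟨Units.mk0 r hr0, ?_⟩
    rw [← diagGL_const, ← map_mul]
    congr 1
    funext i
    simp

end Diagonal

/-! ### The elements `e` and `f` -/

section Cyclic

variable {K : Type*} [Field K]

theorem finRotate_pow_self (p : ℕ) : finRotate p ^ p = 1 := by
  match p with
  | 0 => rfl
  | 1 => exact Subsingleton.elim _ _
  | m + 2 =>
    have h : orderOf (finRotate (m + 2)) = m + 2 := by
      rw [(isCycle_finRotate (n := m)).orderOf, support_finRotate, Finset.card_univ, Fintype.card_fin]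
    exact orderOf_dvd_iff_pow_eq_one.1 h.dvd

/-- The permutation of the indices which moves every block to the next one. -/
abbrev blockRotate (p k : ℕ) : Equiv.Perm (Fin (p * k)) :=
  finProdFinEquiv.permCongr ((finRotate p).prodCongr (Equiv.refl (Fin k)))

theorem blockRotate_pow_self (p k : ℕ) : blockRotate p k ^ p = 1 := by
  have h : ∀ m : ℕ, blockRotate p k ^ m =
      finProdFinEquiv.permCongr ((finRotate p ^ m).prodCongr (Equiv.refl (Fin k))) := by
    intro m
    induction m with
    | zero => exact (Equiv.permCongr_refl _).symm
    | succ m ih =>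
      rw [pow_succ, ih]
      ext i
      simp [pow_succ]
  rw [h, finRotate_pow_self]
  exact Equiv.permCongr_refl _

/-- The diagonal entries of the matrix defining `e`. -/
abbrev blockPowers (p k : ℕ) (α : Kˣ) : Fin (p * k) → Kˣ :=
  fun i => α ^ ((finProdFinEquiv.symm i).1 : ℕ)

theorem pow_finRotate {p : ℕ} {α : Kˣ} (hα : α ^ p = 1) (i : Fin p) :
    α ^ (finRotate p i : ℕ) = α * α ^ (i : ℕ) := by
  obtain _ | m := p
  · exact i.elim0
  · rw [coe_finRotate, ← pow_succ']
    split_ifs with h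
    -- Wrap-around from the last block to block `0`: here `α ^ p = 1` is needed.
    · rw [h, Fin.val_last, hα, pow_zero]
    · rfl

/-- Shifting the blocks cyclically multiplies every eigenvalue by `α`. -/
theorem permGL_blockRotate_mem_twistedCentralizer {p : ℕ} (k : ℕ) {α : Kˣ} (hα : α ^ p = 1) :
    permGL (blockRotate p k) ∈ twistedCentralizer (diagGL (blockPowers p k α)) α := by
  rw [mem_twistedCentralizer, permGL_mul_diagGL, ← mul_assoc, ← diagGL_const, ← map_mul]
  congr 2
  funext i
  simp only [blockPowers, blockRotate, Function.comp_apply, Equiv.permCongr_apply,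
    Equiv.symm_apply_apply, Equiv.prodCongr_apply, Prod.map_fst, Pi.mul_apply, pow_finRotate hα]

theorem blockPowers_pow_eq_one {p : ℕ} (k : ℕ) {α : Kˣ} (hα : α ^ p = 1) (i : Fin (p * k)) :
    blockPowers p k α i ^ p = 1 := by
  rw [← pow_mul, mul_comm, pow_mul, hα, one_pow]

theorem permGL_blockRotate_pow_self (p k : ℕ) :
    (permGL (blockRotate p k) : GL (Fin (p * k)) K) ^ p = 1 := by
  rw [permGL_pow, blockRotate_pow_self, permGL_one]

theorem f_pow_eq_mk (p k m : ℕ) :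
    f K p k ^ m = QuotientGroup.mk (permGL (blockRotate p k) ^ m) := rfl

theorem exists_nat_pow_of_mem_zpowers_f {p k : ℕ} (hp : 0 < p) {x : PGL (Fin (p * k)) K}
    (hx : x ∈ Subgroup.zpowers (f K p k)) : ∃ m : ℕ, f K p k ^ m = x := by
  have hfin : IsOfFinOrder (f K p k) := isOfFinOrder_iff_pow_eq_one.2
    ⟨p, hp, by rw [f_pow_eq_mk, permGL_blockRotate_pow_self]; rfl⟩
  exact (IsOfFinOrder.mem_powers_iff_mem_zpowers hfin).2 hx

variable {p k : ℕ} {α : Kˣ}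

theorem orderOf_e [Nonempty (Fin (p * k))] (hp : p.Prime) (hα : IsPrimitiveRoot α p) :
    orderOf (e p k α) = p := by
  have : Fact p.Prime := ⟨hp⟩
  refine orderOf_eq_prime ?_ fun h => ?_
  · change (QuotientGroup.mk (diagGL (blockPowers p k α) ^ p) : PGL (Fin (p * k)) K) = 1
    rw [diagGL_pow_eq_one (blockPowers_pow_eq_one k hα.pow_eq_one)]
    rfl
  -- If `e` were trivial, the block permutation would lie in both pieces `1` and `α`.
  · have hcomm := Subgroup.mem_center_iff.1 ((QuotientGroup.eq_one_iff _).1 h)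
      (permGL (blockRotate p k))
    refine hα.ne_one hp.one_lt (eq_of_mem_twistedCentralizer
      (permGL_blockRotate_mem_twistedCentralizer k hα.pow_eq_one) ?_)
    rw [mem_twistedCentralizer, map_one, one_mul]
    exact hcomm

theorem hasDisconnectedCentralizer_e [Nonempty (Fin (p * k))] [Infinite K] (hp : p.Prime)
    (hα : IsPrimitiveRoot α p) : HasDisconnectedCentralizer (e p k α) :=
  (hasDisconnectedCentralizer_mk_iff hp.pos
    (diagGL_pow_eq_one (blockPowers_pow_eq_one k hα.pow_eq_one))).2
    ⟨α, hα.ne_one hp.one_lt, _, permGL_blockRotate_mem_twistedCentralizer k hα.pow_eq_one⟩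

theorem isConj_e [Nonempty (Fin (p * k))] [IsAlgClosed K] (hp : p.Prime)
    (hα : IsPrimitiveRoot α p) {x : PGL (Fin (p * k)) K} (hx : IsToral x) (hxp : orderOf x = p)
    (hdisc : HasDisconnectedCentralizer x) : IsConj x (e p k α) := by
  have : Infinite K := IsAlgClosed.instInfinite
  have : Fact p.Prime := ⟨hp⟩
  obtain ⟨d, hd, hconj⟩ := hx.exists_isConj_diagGL hp.pos (orderOf_dvd_iff_pow_eq_one.1 hxp.dvd)
  refine hconj.trans ?_
  have hdisc' := (hasDisconnectedCentralizer_iff_of_isConj hp.pos (diagGL_pow_eq_one hd)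
    hconj.symm).2 hdisc
  obtain ⟨c, hc1, h, hh⟩ := (hasDisconnectedCentralizer_mk_iff hp.pos (diagGL_pow_eq_one hd)).1
    hdisc'
  have hcp := pow_eq_one_of_mem_twistedCentralizer (diagGL_pow_eq_one hd) hh
  have hcprim : IsPrimitiveRoot c p :=
    IsPrimitiveRoot.iff_orderOf.2 (orderOf_eq_prime hcp hc1)
  -- As `c` is primitive, `α = c ^ m`, and `h ^ m` moves the witness from the piece `c` to the piece
  -- `α`.
  obtain ⟨m, -, hm⟩ := (IsPrimitiveRoot.coe_units_iff.2 hcprim).eq_pow_of_pow_eq_one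
    (IsPrimitiveRoot.coe_units_iff.2 hα).pow_eq_one
  have hm' : c ^ m = α := Units.ext (by simpa using hm)
  exact (QuotientGroup.mk' (Subgroup.center (GL (Fin (p * k)) K))).map_isConj
    (isConj_diagGL_of_twistedCentralizer_nonempty hp hα hd
    (blockPowers_pow_eq_one k hα.pow_eq_one) ⟨_, hm' ▸ pow_mem_twistedCentralizer hh m⟩
    ⟨_, permGL_blockRotate_mem_twistedCentralizer k hα.pow_eq_one⟩)

theorem setOf_toral_disconnected_eq [Nonempty (Fin (p * k))] [IsAlgClosed K] (hp : p.Prime)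
    (hα : IsPrimitiveRoot α p) :
    {x : PGL (Fin (p * k)) K | IsToral x ∧ orderOf x = p ∧ HasDisconnectedCentralizer x} =
      (ConjClasses.mk (e p k α)).carrier := by
  have : Infinite K := IsAlgClosed.instInfinite
  ext x
  rw [ConjClasses.mem_carrier_iff_mk_eq, ConjClasses.mk_eq_mk_iff_isConj]
  refine ⟨fun ⟨h1, h2, h3⟩ => isConj_e hp hα h1 h2 h3, fun h => ⟨?_, ?_, ?_⟩⟩
  · exact ⟨_, ⟨blockPowers p k α, rfl⟩, h⟩
  · obtain ⟨b, hb⟩ := isConj_iff.1 h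
    refine Eq.trans ?_ (orderOf_e (k := k) hp hα)
    rw [← hb]
    exact (orderOf_injective (MulAut.conj b).toMonoidHom (MulAut.conj b).injective x).symm
  · exact (hasDisconnectedCentralizer_iff_of_isConj hp.pos
      (diagGL_pow_eq_one (blockPowers_pow_eq_one k hα.pow_eq_one)) h.symm).1
      (hasDisconnectedCentralizer_e hp hα)

theorem identityComponent_centralizer_e [Nonempty (Fin (p * k))] [Infinite K] (hp : p.Prime)
    (hα : IsPrimitiveRoot α p) :
    identityComponent (centralizer (e p k α)) =
      QuotientGroup.mk '' twistedCentralizer (diagGL (blockPowers p k α)) 1 :=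
  identityComponent_centralizer_mk hp.pos
    (diagGL_pow_eq_one (blockPowers_pow_eq_one k hα.pow_eq_one))

theorem centralizer_e_eq_mul [Nonempty (Fin (p * k))] [Infinite K] (hp : p.Prime)
    (hα : IsPrimitiveRoot α p) :
    (centralizer (e p k α) : Set (PGL (Fin (p * k)) K)) =
      identityComponent (centralizer (e p k α)) *
        (Subgroup.zpowers (f K p k) : Set (PGL (Fin (p * k)) K)) := by
  have : NeZero p := ⟨hp.ne_zero⟩
  have hf := permGL_blockRotate_mem_twistedCentralizer k hα.pow_eq_one
  rw [identityComponent_centralizer_e hp hα]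
  refine Set.Subset.antisymm (fun x hx => ?_) (Set.mul_subset_iff.2 fun x hx y hy => ?_)
  · obtain ⟨h, rfl⟩ := QuotientGroup.mk_surjective x
    obtain ⟨c, hc⟩ := mk_mem_centralizer_iff.1 hx
    have hcp := pow_eq_one_of_mem_twistedCentralizer
      (diagGL_pow_eq_one (blockPowers_pow_eq_one k hα.pow_eq_one)) hc
    obtain ⟨m, -, hm⟩ := (IsPrimitiveRoot.coe_units_iff.2 hα).eq_pow_of_pow_eq_one
      (show (c : K) ^ p = 1 by rw [← Units.val_pow_eq_pow_val, hcp, Units.val_one])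
    have hm' : α ^ m = c := Units.ext (by simpa using hm)
    have hfm := pow_mem_twistedCentralizer hf m
    rw [hm'] at hfm
    -- An element of the piece `c = α ^ m` is brought into the piece `1` by `f ^ (-m)`.
    refine Set.mem_mul.2 ⟨QuotientGroup.mk (h * (permGL (blockRotate p k) ^ m)⁻¹), ⟨_, ?_, rfl⟩,
      f K p k ^ m, Subgroup.npow_mem_zpowers _ _, ?_⟩
    · rw [← mul_inv_cancel c]
      exact mul_mem_twistedCentralizer hc (inv_mem_twistedCentralizer hfm)
    · rw [f_pow_eq_mk, ← QuotientGroup.mk_mul, inv_mul_cancel_right]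
  · obtain ⟨m, rfl⟩ := exists_nat_pow_of_mem_zpowers_f hp.pos hy
    exact mul_mem (image_twistedCentralizer_subset _ _ hx)
      (pow_mem (mk_mem_centralizer_iff.2 ⟨α, hf⟩) m)

theorem identityComponent_inter_zpowers_f [Nonempty (Fin (p * k))] [Infinite K] (hp : p.Prime)
    (hα : IsPrimitiveRoot α p) :
    identityComponent (centralizer (e p k α)) ∩
      (Subgroup.zpowers (f K p k) : Set (PGL (Fin (p * k)) K)) = {1} := by
  rw [identityComponent_centralizer_e hp hα]
  refine Set.Subset.antisymm ?_ (Set.singleton_subset_iff.2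
    ⟨⟨1, one_mem_twistedCentralizer _, rfl⟩, one_mem _⟩)
  rintro x ⟨hx, hxf⟩
  obtain ⟨m, rfl⟩ := exists_nat_pow_of_mem_zpowers_f hp.pos hxf
  rw [f_pow_eq_mk, mk_mem_image_twistedCentralizer_iff] at hx
  have hm := eq_of_mem_twistedCentralizer (pow_mem_twistedCentralizer
    (permGL_blockRotate_mem_twistedCentralizer k hα.pow_eq_one) m) hx
  -- `f ^ m` lies in the pieces `α ^ m` and `1`, so `α ^ m = 1` and `p` divides `m`.
  obtain ⟨j, rfl⟩ := hα.dvd_of_pow_eq_one m hm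
  rw [Set.mem_singleton_iff, f_pow_eq_mk, pow_mul, permGL_blockRotate_pow_self, one_pow]
  rfl

end Cyclic

end PGLCentralizer

end

theorem theorem4p26 {K : Type*} [Field K] [IsAlgClosed K] (p k : ℕ) (hp : p.Prime) (hp2 : Odd p)
    (hk : 1 ≤ k) (α : Kˣ) (hα : IsPrimitiveRoot (α : K) p) :
    (∃! c : ConjClasses (PGLCentralizer.PGL (Fin (p * k)) K),
      ∀ x ∈ c.carrier, PGLCentralizer.IsToral x ∧ orderOf x = p ∧
        PGLCentralizer.HasDisconnectedCentralizer x) ∧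
    {x : PGLCentralizer.PGL (Fin (p * k)) K | PGLCentralizer.IsToral x ∧ orderOf x = p ∧
        PGLCentralizer.HasDisconnectedCentralizer x} =
      (ConjClasses.mk (PGLCentralizer.e p k α)).carrier ∧
    (PGLCentralizer.centralizer (PGLCentralizer.e p k α) :
        Set (PGLCentralizer.PGL (Fin (p * k)) K)) =
      PGLCentralizer.identityComponent (PGLCentralizer.centralizer (PGLCentralizer.e p k α)) *
        (Subgroup.zpowers (PGLCentralizer.f K p k) :
          Set (PGLCentralizer.PGL (Fin (p * k)) K)) ∧
    PGLCentralizer.identityComponent (PGLCentralizer.centralizer (PGLCentralizer.e p k α)) ∩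
        (Subgroup.zpowers (PGLCentralizer.f K p k) :
          Set (PGLCentralizer.PGL (Fin (p * k)) K)) = {1} := by
  have : Infinite K := IsAlgClosed.instInfinite
  have : Nonempty (Fin (p * k)) := ⟨⟨0, Nat.mul_pos hp.pos hk⟩⟩
  have hα' : IsPrimitiveRoot α p := IsPrimitiveRoot.coe_units_iff.1 hα
  have hset := PGLCentralizer.setOf_toral_disconnected_eq (k := k) hp hα'
  refine ⟨⟨ConjClasses.mk (PGLCentralizer.e p k α), fun x hx => hset.symm.subset hx, ?_⟩, hset,
    PGLCentralizer.centralizer_e_eq_mul hp hα',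
    PGLCentralizer.identityComponent_inter_zpowers_f hp hα'⟩
  -- Classes are nonempty, so one representative already places `c` in the class of `e`.
  intro c hc
  obtain ⟨x, rfl⟩ := ConjClasses.exists_rep c
  exact ConjClasses.mem_carrier_iff_mk_eq.1 (hset.subset (hc x ConjClasses.mem_carrier_mk))
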